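/- Let $G$ be a finite simple graph of order $n\ge 26$, and let $\rho(\cdot)$ denote the spectral radius of the adjacency matrix of a graph. Let $K^+_{1,n-1}$ be the graph obtained from the star $K_{1,n-1}$ by adding one edge joining two of its leaves. If $\rho(G)\ge\rho(K^+_{1,n-1})$, then $G$ contains two distinct cycles of the same length unless $G\cong K^+_{1,n-1}$; and $K^+_{1,n-1}$ itself does not contain two distinct cycles of the same length. -/

import Mathlib

/-- The spectral radius `ρ(G)` of a finite simple graph: the spectral radius (largest absolute
value of an eigenvalue) of its adjacency matrix. The matrix is real symmetric, so all its
eigenvalues are real and the real spectrum is the whole spectrum. -/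
noncomputable def graphSpectralRadius {V : Type*} [Fintype V] (G : SimpleGraph V) : ENNReal :=
  open Classical in spectralRadius ℝ (G.adjMatrix ℝ)

/-- The graph `K⁺_{1,n-1}` on the vertices `0, …, n-1`: the star with centre `0`, together with
one extra edge joining the two leaves `1` and `2` (intended for `3 ≤ n`). -/
def starPlusEdge (n : ℕ) : SimpleGraph (Fin n) :=
  SimpleGraph.fromRel fun i j => i.val = 0 ∨ (i.val = 1 ∧ j.val = 2)

/-- `G` contains two different cycles of the same length. Cycles are compared as subgraphs, so
that closed walks traversing the same cycle from another starting vertex or in the other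
direction are not counted as different. -/
def HasTwoCyclesOfSameLength {V : Type*} (G : SimpleGraph V) : Prop :=
  ∃ (u v : V) (p : G.Walk u u) (q : G.Walk v v),
    p.IsCycle ∧ q.IsCycle ∧ p.length = q.length ∧ p.toSubgraph ≠ q.toSubgraph

open Finset

/-! The spectral hypothesis is used only through `ρ(G) > √(n-1) ≥ 5`. Let `x` be the entrywise
absolute value of an eigenvector whose eigenvalue exceeds `√(n-1)` in modulus, scaled to have
maximum `1`, attained at `u`. Let `N`, `B`, `F` be the vertices at distance one, two and more (or
infinite) from `u`. Applying the eigenvalue inequality twice at `u` gives `ρ² ≤ |N| + β + Q`, where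
`β` and `Q` are the weights reached from `N` inside `N` and inside `B`.

If no two cycles share a length, then triangles, quadrilaterals and pentagons near `u` are so scarce
that `β + Q ≤ |B| + |F|` whenever `B ∪ F` is nonempty (`sq_le_card_add_of_subharmonic`). This yields
`ρ² ≤ n - 1`, a contradiction, so `u` dominates. A bare star also has `ρ² ≤ n - 1`, so `N` spans an
edge, and only one because two would give two triangles: the graph is `K⁺_{1,n-1}`. -/

/-! ### Short cycles and their vertex sets -/

theorem exists_isCycle_three {V : Type*} {G : SimpleGraph V} {a b c : V}
    (hab : G.Adj a b) (hbc : G.Adj b c) (hca : G.Adj c a) :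
    ∃ p : G.Walk a a, p.IsCycle ∧ p.length = 3 ∧
      ∀ z, z ∈ p.toSubgraph.verts ↔ z = a ∨ z = b ∨ z = c := by
  refine ⟨.cons hab (.cons hbc (.cons hca .nil)), ?_, rfl, ?_⟩
  · rw [SimpleGraph.Walk.isCycle_iff_isPath_tail_and_le_length]
    simp [SimpleGraph.Walk.isPath_def, hbc.ne, hca.ne, hab.ne']
  · intro z
    simp
    tauto

theorem exists_isCycle_four {V : Type*} {G : SimpleGraph V} {a b c d : V}
    (hab : G.Adj a b) (hbc : G.Adj b c) (hcd : G.Adj c d) (hda : G.Adj d a)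
    (hac : a ≠ c) (hbd : b ≠ d) :
    ∃ p : G.Walk a a, p.IsCycle ∧ p.length = 4 ∧
      ∀ z, z ∈ p.toSubgraph.verts ↔ z = a ∨ z = b ∨ z = c ∨ z = d := by
  refine ⟨.cons hab (.cons hbc (.cons hcd (.cons hda .nil))), ?_, rfl, ?_⟩
  · rw [SimpleGraph.Walk.isCycle_iff_isPath_tail_and_le_length]
    simp [SimpleGraph.Walk.isPath_def, hab.ne', hbc.ne, hcd.ne, hda.ne, hac.symm, hbd]
  · intro z
    simp
    tauto

theorem exists_isCycle_five {V : Type*} {G : SimpleGraph V} {a b c d e : V}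
    (hab : G.Adj a b) (hbc : G.Adj b c) (hcd : G.Adj c d) (hde : G.Adj d e) (hea : G.Adj e a)
    (hac : a ≠ c) (had : a ≠ d) (hbd : b ≠ d) (hbe : b ≠ e) (hce : c ≠ e) :
    ∃ p : G.Walk a a, p.IsCycle ∧ p.length = 5 ∧
      ∀ z, z ∈ p.toSubgraph.verts ↔ z = a ∨ z = b ∨ z = c ∨ z = d ∨ z = e := by
  refine ⟨.cons hab (.cons hbc (.cons hcd (.cons hde (.cons hea .nil)))), ?_, rfl, ?_⟩
  · rw [SimpleGraph.Walk.isCycle_iff_isPath_tail_and_le_length]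
    simp [SimpleGraph.Walk.isPath_def, hab.ne', hbc.ne, hcd.ne, hde.ne, hea.ne, hac.symm,
      had.symm, hbd, hbe, hce]
  · intro z
    simp
    tauto

/-- Cycles with different vertex sets are different subgraphs, so uniqueness per length forces equal
vertex sets. The next two lemmas are the analogues for lengths 4 and 5. -/
theorem mem_triangle_of_mem_triangle {V : Type*} {G : SimpleGraph V}
    (h : ¬ HasTwoCyclesOfSameLength G) {a b c a' b' c' : V}
    (hab : G.Adj a b) (hbc : G.Adj b c) (hca : G.Adj c a)
    (hab' : G.Adj a' b') (hbc' : G.Adj b' c') (hca' : G.Adj c' a') {z : V}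
    (hz : z = a ∨ z = b ∨ z = c) : z = a' ∨ z = b' ∨ z = c' := by
  obtain ⟨p, hp, hpl, hpv⟩ := exists_isCycle_three hab hbc hca
  obtain ⟨q, hq, hql, hqv⟩ := exists_isCycle_three hab' hbc' hca'
  by_contra hne
  refine h ⟨a, a', p, q, hp, hq, by rw [hpl, hql], fun heq => hne ?_⟩
  rw [← hqv, ← heq, hpv]
  exact hz

theorem mem_quadrilateral_of_mem_quadrilateral {V : Type*} {G : SimpleGraph V}
    (h : ¬ HasTwoCyclesOfSameLength G) {a b c d a' b' c' d' : V}
    (hab : G.Adj a b) (hbc : G.Adj b c) (hcd : G.Adj c d) (hda : G.Adj d a)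
    (hac : a ≠ c) (hbd : b ≠ d)
    (hab' : G.Adj a' b') (hbc' : G.Adj b' c') (hcd' : G.Adj c' d') (hda' : G.Adj d' a')
    (hac' : a' ≠ c') (hbd' : b' ≠ d') {z : V}
    (hz : z = a ∨ z = b ∨ z = c ∨ z = d) : z = a' ∨ z = b' ∨ z = c' ∨ z = d' := by
  obtain ⟨p, hp, hpl, hpv⟩ := exists_isCycle_four hab hbc hcd hda hac hbd
  obtain ⟨q, hq, hql, hqv⟩ := exists_isCycle_four hab' hbc' hcd' hda' hac' hbd'
  by_contra hne
  refine h ⟨a, a', p, q, hp, hq, by rw [hpl, hql], fun heq => hne ?_⟩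
  rw [← hqv, ← heq, hpv]
  exact hz

theorem mem_pentagon_of_mem_pentagon {V : Type*} {G : SimpleGraph V}
    (h : ¬ HasTwoCyclesOfSameLength G) {a b c d e a' b' c' d' e' : V}
    (hab : G.Adj a b) (hbc : G.Adj b c) (hcd : G.Adj c d) (hde : G.Adj d e) (hea : G.Adj e a)
    (hac : a ≠ c) (had : a ≠ d) (hbd : b ≠ d) (hbe : b ≠ e) (hce : c ≠ e)
    (hab' : G.Adj a' b') (hbc' : G.Adj b' c') (hcd' : G.Adj c' d') (hde' : G.Adj d' e')
    (hea' : G.Adj e' a')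
    (hac' : a' ≠ c') (had' : a' ≠ d') (hbd' : b' ≠ d') (hbe' : b' ≠ e') (hce' : c' ≠ e') {z : V}
    (hz : z = a ∨ z = b ∨ z = c ∨ z = d ∨ z = e) :
    z = a' ∨ z = b' ∨ z = c' ∨ z = d' ∨ z = e' := by
  obtain ⟨p, hp, hpl, hpv⟩ := exists_isCycle_five hab hbc hcd hde hea hac had hbd hbe hce
  obtain ⟨q, hq, hql, hqv⟩ := exists_isCycle_five hab' hbc' hcd' hde' hea' hac' had' hbd' hbe' hce'
  by_contra hne
  refine h ⟨a, a', p, q, hp, hq, by rw [hpl, hql], fun heq => hne ?_⟩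
  rw [← hqv, ← heq, hpv]
  exact hz

/-! ### The weight estimate -/

/-- The numerical core of the weight estimate: `k = |B|`, `f = |F|`, `S` and `φ` are the total
weights of `B` and `F`, `w` is the weight of the one vertex of `B` that may have two neighbours in
`N`, and `P`, `D` are the weights reached from `B` inside `N` and inside `B`. -/
theorem excess_le_of_linear_bounds {k f : ℕ} {S w β Q P D φ : ℝ}
    (hkf : 1 ≤ k + f) (hk0 : k = 0 → Q = 0) (hf0 : f = 0 → φ = 0)
    (hwS : w ≤ S) (hw1 : w ≤ 1) (hSk : S ≤ k) (hQ : Q ≤ S + w)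
    (hβ2 : β ≤ 2) (hβ : 4 * β ≤ 2 + Q) (hP : P ≤ k + 1) (hP' : 5 * P ≤ k + 1 + k * β + k * Q)
    (hD : D ≤ 4) (hD' : D ≤ (k - 1) * S) (hS : 5 * S ≤ P + D + k * φ)
    (hφ : φ ≤ f) (hφ' : 5 * φ ≤ f * S + (f - 1) * φ) :
    β + Q ≤ k + f := by
  rcases Nat.eq_zero_or_pos k with rfl | hk
  · have : (1 : ℝ) ≤ f := by exact_mod_cast (by omega : 1 ≤ f)
    have := hk0 rfl
    push_cast at *
    linarith
  -- Already `β + Q ≤ 2 + (k + 1)`, which settles `f ≥ 3`. Otherwise `f` is a numeral; the products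
  -- with `k` become linear by bounding `k * φ` for large `k` and by enumerating small `k`.
  rcases le_or_gt 3 f with hf | hf
  · have : (3 : ℝ) ≤ f := by exact_mod_cast hf
    linarith
  rcases le_or_gt 4 k with hk4 | hk4
  · have : (4 : ℝ) ≤ k := by exact_mod_cast hk4
    have : (k : ℝ) * φ ≤ k * f := mul_le_mul_of_nonneg_left hφ (by positivity)
    interval_cases f <;> push_cast at * <;> linarith
  · interval_cases f
    · have := hf0 rfl
      subst this
      interval_cases k <;> push_cast at * <;> linarith
    · interval_cases k <;> push_cast at * <;> linarith
    · interval_cases k <;> push_cast at * <;> linarith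

theorem sum_sum_mul_le_card_mul {V : Type*} {A : V → V → ℝ} {x : V → ℝ} (s t : Finset V)
    (hA1 : ∀ v w, A v w ≤ 1) (hx : ∀ v, 0 ≤ x v) :
    ∑ v ∈ s, ∑ w ∈ t, A v w * x w ≤ #s * ∑ w ∈ t, x w := by
  rw [← nsmul_eq_mul]
  refine sum_le_card_nsmul _ _ _ fun v _ => sum_le_sum fun w _ => ?_
  exact mul_le_of_le_one_left (hx w) (hA1 v w)

theorem sum_sum_mul_self_le_card_sub_one_mul {V : Type*} {A : V → V → ℝ} {x : V → ℝ}
    (s : Finset V) (hA1 : ∀ v w, A v w ≤ 1) (hA : ∀ v, A v v = 0) (hx : ∀ v, 0 ≤ x v) :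
    ∑ v ∈ s, ∑ w ∈ s, A v w * x w ≤ ((#s : ℝ) - 1) * ∑ w ∈ s, x w := by
  classical
  rw [sum_comm, mul_sum]
  refine sum_le_sum fun w hw => ?_
  rw [← sum_mul]
  refine mul_le_mul_of_nonneg_right ?_ (hx w)
  -- The zero diagonal saves one term in each column.
  rw [← sum_erase s (f := fun v => A v w) (hA w)]
  have := sum_le_card_nsmul (s.erase w) (fun v => A v w) 1 fun v _ => hA1 v w
  rwa [card_erase_of_mem hw, nsmul_one, Nat.cast_sub (card_pos.2 ⟨w, hw⟩), Nat.cast_one] at this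

theorem sum_mul_le_sum_add_of_le_one_of_ne {V : Type*} {p x : V → ℝ} {s : Finset V} {w : V}
    (hw : w ∈ s) (hp : ∀ v ∈ s, v ≠ w → p v ≤ 1) (hpw : p w ≤ 2) (hx : ∀ v, 0 ≤ x v) :
    ∑ v ∈ s, p v * x v ≤ ∑ v ∈ s, x v + x w := by
  classical
  rw [← add_sum_erase s _ hw, ← add_sum_erase s x hw]
  have h1 : ∑ v ∈ s.erase w, p v * x v ≤ ∑ v ∈ s.erase w, x v :=
    sum_le_sum fun v hv =>
      mul_le_of_le_one_left (hx v) (hp v (mem_of_mem_erase hv) (ne_of_mem_erase hv))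
  have h2 := mul_le_mul_of_nonneg_right hpw (hx w)
  linarith

/-- `u` is a vertex of maximal weight `1`, and `N`, `B`, `F` are the vertices at distance one,
two and more from it. -/
theorem sq_le_card_add_of_subharmonic {V : Type*} [Fintype V] {A : V → V → ℝ} {x : V → ℝ}
    {ρ : ℝ} {u : V} {N B F : Finset V}
    (hsum : ∀ g : V → ℝ, ∑ v, g v = g u + ∑ v ∈ N, g v + ∑ v ∈ B, g v + ∑ v ∈ F, g v)
    (hA0 : ∀ v w, 0 ≤ A v w) (hA1 : ∀ v w, A v w ≤ 1) (hA : ∀ v, A v v = 0)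
    (hsymm : ∀ v w, A v w = A w v)
    (hx0 : ∀ v, 0 ≤ x v) (hx1 : ∀ v, x v ≤ 1) (hxu : x u = 1)
    (hρ : 5 ≤ ρ) (hρx : ∀ v, ρ * x v ≤ ∑ w, A v w * x w)
    (huN : ∀ a ∈ N, A u a = 1) (huB : ∀ v ∈ B, A u v = 0) (huF : ∀ v ∈ F, A u v = 0)
    (hNF : ∀ a ∈ N, ∀ f ∈ F, A a f = 0)
    (ht1 : ∀ a ∈ N, ∑ b ∈ N, A a b ≤ 1) (ht2 : ∑ a ∈ N, ∑ b ∈ N, A a b ≤ 2)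
    (hp : B.Nonempty → ∃ w ∈ B, (∀ v ∈ B, v ≠ w → ∑ a ∈ N, A v a ≤ 1) ∧ ∑ a ∈ N, A w a ≤ 2)
    (hBB : ∑ v ∈ B, ∑ w ∈ B, A v w ≤ 4) (hBF : 1 ≤ #B + #F) :
    ρ ^ 2 ≤ #N + #B + #F := by
  set β := ∑ a ∈ N, ∑ b ∈ N, A a b * x b with hβdef
  set Q := ∑ a ∈ N, ∑ v ∈ B, A a v * x v with hQdef
  set S := ∑ v ∈ B, x v with hSdef
  set φ := ∑ v ∈ F, x v with hφdef
  set P := ∑ v ∈ B, ∑ a ∈ N, A v a * x a with hPdef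
  set D := ∑ v ∈ B, ∑ w ∈ B, A v w * x w with hDdef
  have hAx0 (v w) : 0 ≤ A v w * x w := mul_nonneg (hA0 v w) (hx0 w)
  have hβ0 : 0 ≤ β := sum_nonneg fun _ _ => sum_nonneg fun _ _ => hAx0 _ _
  have hQ0 : 0 ≤ Q := sum_nonneg fun _ _ => sum_nonneg fun _ _ => hAx0 _ _
  have hP0 : 0 ≤ P := sum_nonneg fun _ _ => sum_nonneg fun _ _ => hAx0 _ _
  have hS0 : 0 ≤ S := sum_nonneg fun _ _ => hx0 _
  have hφ0 : 0 ≤ φ := sum_nonneg fun _ _ => hx0 _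
  have hxN (a) (ha : a ∈ N) : ρ * x a ≤ 1 + ∑ b ∈ N, A a b * x b + ∑ v ∈ B, A a v * x v := by
    have h := hρx a
    rw [hsum, hsymm a u, huN a ha, hxu,
      sum_eq_zero (s := F) fun f hf => by rw [hNF a ha f hf, zero_mul]] at h
    linarith
  have hβQ : ρ ^ 2 ≤ #N + (β + Q) := by
    have h := hρx u
    rw [hsum, hA u, sum_congr rfl fun a ha => by rw [huN a ha, one_mul],
      sum_eq_zero (s := F) fun f hf => by rw [huF f hf, zero_mul],
      sum_eq_zero (s := B) fun f hf => by rw [huB f hf, zero_mul], hxu] at h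
    have h2 := sum_le_sum hxN
    rw [sum_add_distrib, sum_add_distrib, ← mul_sum, sum_const, nsmul_one] at h2
    have h3 : ρ * (ρ * 1) ≤ ρ * ∑ a ∈ N, x a := mul_le_mul_of_nonneg_left (by linarith) (by linarith)
    nlinarith
  -- a weighted sum of `x` over the neighbours of `u`
  have hweighted (c : V → ℝ) (C : ℝ) (hc0 : ∀ a ∈ N, 0 ≤ c a) (hc : ∀ a ∈ N, c a ≤ C) :
      ρ * ∑ a ∈ N, c a * x a ≤ ∑ a ∈ N, c a + C * β + C * Q := by
    rw [hβdef, hQdef, mul_sum, mul_sum, mul_sum, ← sum_add_distrib, ← sum_add_distrib]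
    refine sum_le_sum fun a ha => ?_
    have h1 := mul_le_mul_of_nonneg_left (hxN a ha) (hc0 a ha)
    have h2 := mul_le_mul_of_nonneg_right (hc a ha)
      (sum_nonneg (s := N) fun b _ => hAx0 a b)
    have h3 := mul_le_mul_of_nonneg_right (hc a ha)
      (sum_nonneg (s := B) fun b _ => hAx0 a b)
    linarith
  have hβeq : β = ∑ a ∈ N, (∑ b ∈ N, A a b) * x a := by
    rw [hβdef, sum_comm]
    refine sum_congr rfl fun a _ => ?_
    rw [sum_mul]
    exact sum_congr rfl fun b _ => by rw [hsymm]
  have hβ2 : β ≤ 2 := by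
    refine le_trans (sum_le_sum fun a _ => sum_le_sum fun b _ => ?_) ht2
    exact mul_le_of_le_one_right (hA0 _ _) (hx1 _)
  have hβ' : 4 * β ≤ 2 + Q := by
    have h := hweighted (fun a => ∑ b ∈ N, A a b) 1
      (fun a _ => sum_nonneg fun b _ => hA0 a b) ht1
    rw [← hβeq] at h
    nlinarith
  have hPeq : P = ∑ a ∈ N, (∑ v ∈ B, A v a) * x a := by
    rw [hPdef, sum_comm]
    exact sum_congr rfl fun a _ => by rw [sum_mul]
  have hQeq : Q = ∑ v ∈ B, (∑ a ∈ N, A v a) * x v := by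
    rw [hQdef, sum_comm]
    refine sum_congr rfl fun v _ => ?_
    rw [sum_mul]
    exact sum_congr rfl fun b _ => by rw [hsymm]
  have hcard : ∑ v ∈ B, ∑ a ∈ N, A v a ≤ #B + 1 := by
    rcases B.eq_empty_or_nonempty with rfl | hB
    · simp
    · obtain ⟨w, hw, h1, h2⟩ := hp hB
      -- With constant weight `1` the estimate counts edges between `B` and `N`.
      simpa using sum_mul_le_sum_add_of_le_one_of_ne (x := fun _ => (1 : ℝ)) hw h1 h2
        fun _ => zero_le_one
  have hP : P ≤ #B + 1 := by
    refine le_trans (sum_le_sum fun a _ => sum_le_sum fun b _ => ?_) hcard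
    exact mul_le_of_le_one_right (hA0 _ _) (hx1 _)
  have hP' : 5 * P ≤ #B + 1 + #B * β + #B * Q := by
    have h := hweighted (fun a => ∑ v ∈ B, A v a) #B
      (fun a _ => sum_nonneg fun v _ => hA0 v a)
      (fun a _ => by simpa using sum_le_card_nsmul B (fun v => A v a) 1 fun v _ => hA1 v a)
    rw [← hPeq, sum_comm] at h
    nlinarith
  have hw : ∃ w, w ≤ S ∧ w ≤ 1 ∧ Q ≤ S + w := by
    rcases B.eq_empty_or_nonempty with rfl | hB
    · exact ⟨0, hS0, zero_le_one, by simp [hQdef, hSdef]⟩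
    · obtain ⟨w, hw, h1, h2⟩ := hp hB
      refine ⟨x w, single_le_sum (fun v _ => hx0 v) hw, hx1 w, ?_⟩
      rw [hQeq]
      exact sum_mul_le_sum_add_of_le_one_of_ne hw h1 h2 hx0
  obtain ⟨w, hwS, hw1, hQw⟩ := hw
  have hD : D ≤ 4 := by
    refine le_trans (sum_le_sum fun a _ => sum_le_sum fun b _ => ?_) hBB
    exact mul_le_of_le_one_right (hA0 _ _) (hx1 _)
  have hS : 5 * S ≤ P + D + #B * φ := by
    have h := sum_le_sum fun v (_ : v ∈ B) => hρx v
    simp only [hsum] at h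
    rw [sum_add_distrib, sum_add_distrib, sum_add_distrib, ← mul_sum,
      sum_eq_zero (f := fun v => A v u * x u) fun v hv => by rw [hsymm, huB v hv, zero_mul]] at h
    have h1 := sum_sum_mul_le_card_mul B F hA1 hx0
    nlinarith
  have hφ' : 5 * φ ≤ #F * S + (#F - 1) * φ := by
    have h := sum_le_sum fun v (_ : v ∈ F) => hρx v
    simp only [hsum] at h
    rw [sum_add_distrib, sum_add_distrib, sum_add_distrib, ← mul_sum,
      sum_eq_zero (f := fun v => A v u * x u) fun v hv => by rw [hsymm, huF v hv, zero_mul],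
      sum_eq_zero (f := fun v => ∑ a ∈ N, A v a * x a) fun v hv =>
        sum_eq_zero fun a ha => by rw [hsymm, hNF a ha v hv, zero_mul]] at h
    have h1 := sum_sum_mul_le_card_mul F B hA1 hx0
    have h2 := sum_sum_mul_self_le_card_sub_one_mul F hA1 hA hx0
    nlinarith
  have hk0 (h : #B = 0) : Q = 0 := by
    rw [card_eq_zero] at h
    simp [hQdef, h]
  have hf0 (h : #F = 0) : φ = 0 := by
    rw [card_eq_zero] at h
    simp [hφdef, h]
  have hSB : S ≤ #B := by simpa using sum_le_card_nsmul B x 1 fun v _ => hx1 v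
  have hφF : φ ≤ #F := by simpa using sum_le_card_nsmul F x 1 fun v _ => hx1 v
  have := excess_le_of_linear_bounds hBF hk0 hf0 hwS hw1 hSB hQw hβ2 hβ' hP hP' hD
    (sum_sum_mul_self_le_card_sub_one_mul B hA1 hA hx0) hS hφF hφ'
  linarith

/-! ### Local structure around the vertex of maximal weight -/

theorem card_le_two_of_eq_or_eq_swap {V : Type*} {T : Finset (V × V)}
    (h : ∀ p ∈ T, ∀ q ∈ T, p = q ∨ p = q.swap) : #T ≤ 2 := by
  classical
  rcases T.eq_empty_or_nonempty with rfl | ⟨q, hq⟩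
  · simp
  · refine (card_le_card (t := {q, q.swap}) fun p hp => ?_).trans card_le_two
    simpa using h p hp q hq

theorem sum_sum_ite_adj {V : Type*} (G : SimpleGraph V) [DecidableRel G.Adj] (s t : Finset V) :
    ∑ v ∈ s, ∑ w ∈ t, (if G.Adj v w then (1 : ℝ) else 0) =
      #((s ×ˢ t).filter fun p => G.Adj p.1 p.2) := by
  rw [← sum_product' s t fun v w => if G.Adj v w then (1 : ℝ) else 0, sum_boole]

section

variable {V : Type*} {G : SimpleGraph V} {u : V}

theorem eq_of_adj_of_common_neighbor (h : ¬ HasTwoCyclesOfSameLength G) {a b c : V}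
    (ha : G.Adj u a) (hb : G.Adj u b) (hc : G.Adj u c) (hab : G.Adj a b) (hac : G.Adj a c) :
    b = c := by
  rcases mem_triangle_of_mem_triangle h ha hab hb.symm ha hac hc.symm
    (Or.inr (Or.inr rfl)) with h1 | h1 | h1
  · exact absurd h1 hb.ne'
  · exact absurd h1 hab.ne'
  · exact h1

/-- The apexes may differ: with apex `u` this handles edges inside `N`, with apexes in `N` it
handles edges inside `B`. -/
theorem eq_or_eq_of_adj_of_triangle (h : ¬ HasTwoCyclesOfSameLength G) {a v w a' v' w' : V}
    (hav : G.Adj a v) (haw : G.Adj a w) (hvw : G.Adj v w)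
    (hav' : G.Adj a' v') (haw' : G.Adj a' w') (hvw' : G.Adj v' w')
    (hva' : v ≠ a') (hwa' : w ≠ a') : (v, w) = (v', w') ∨ (v, w) = (w', v') := by
  have h1 := mem_triangle_of_mem_triangle h hav hvw haw.symm hav' hvw' haw'.symm
    (z := v) (by tauto)
  have h2 := mem_triangle_of_mem_triangle h hav hvw haw.symm hav' hvw' haw'.symm
    (z := w) (by tauto)
  have := hvw.ne
  grind

theorem eq_or_eq_of_adj_of_pentagon (h : ¬ HasTwoCyclesOfSameLength G) {a b v w a' b' v' w' : V}
    (ha : G.Adj u a) (hb : G.Adj u b) (hav : G.Adj a v) (hbw : G.Adj b w) (hvw : G.Adj v w)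
    (ha' : G.Adj u a') (hb' : G.Adj u b') (hav' : G.Adj a' v') (hbw' : G.Adj b' w')
    (hvw' : G.Adj v' w') (hab : a ≠ b) (hab' : a' ≠ b')
    (hv : v ≠ u ∧ ¬ G.Adj u v) (hw : w ≠ u ∧ ¬ G.Adj u w)
    (hv' : v' ≠ u ∧ ¬ G.Adj u v') (hw' : w' ≠ u ∧ ¬ G.Adj u w') :
    (v, w) = (v', w') ∨ (v, w) = (w', v') := by
  have hne {s t : V} (hs : G.Adj u s) (ht : ¬ G.Adj u t) : s ≠ t := fun h => ht (h ▸ hs)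
  have key (z) := mem_pentagon_of_mem_pentagon h ha hav hvw hbw.symm hb.symm
    hv.1.symm hw.1.symm (hne ha hw.2) hab (hne hb hv.2).symm ha' hav' hvw' hbw'.symm hb'.symm
    hv'.1.symm hw'.1.symm (hne ha' hw'.2) hab' (hne hb' hv'.2).symm (z := z)
  have h1 := key v (by tauto)
  have h2 := key w (by tauto)
  have := hvw.ne
  grind

/-- The quadrilaterals `u a v b` and `u a' w b'` have the same vertices, and `v` is neither `u` nor
a neighbour of `u`. -/
theorem eq_of_two_common_neighbors (h : ¬ HasTwoCyclesOfSameLength G) {a b a' b' v w : V}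
    (ha : G.Adj u a) (hb : G.Adj u b) (hva : G.Adj v a) (hvb : G.Adj v b) (hab : a ≠ b)
    (ha' : G.Adj u a') (hb' : G.Adj u b') (hwa' : G.Adj w a') (hwb' : G.Adj w b') (hab' : a' ≠ b')
    (hv : v ≠ u ∧ ¬ G.Adj u v) (hw : w ≠ u) : v = w := by
  have h1 := mem_quadrilateral_of_mem_quadrilateral h ha hva.symm hvb hb.symm hv.1.symm hab
    ha' hwa'.symm hwb' hb'.symm hw.symm hab' (z := v) (by tauto)
  grind

theorem not_three_common_neighbors (h : ¬ HasTwoCyclesOfSameLength G) {a b c v : V}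
    (ha : G.Adj u a) (hb : G.Adj u b) (hc : G.Adj u c)
    (hva : G.Adj v a) (hvb : G.Adj v b) (hvc : G.Adj v c) (hab : a ≠ b) (hac : a ≠ c)
    (hbc : b ≠ c) (hv : v ≠ u) : False := by
  have h1 := mem_quadrilateral_of_mem_quadrilateral h ha hva.symm hvb hb.symm hv.symm hab
    ha hva.symm hvc hc.symm hv.symm hac (z := b) (by tauto)
  rcases h1 with h1 | h1 | h1 | h1
  · exact hb.ne' h1
  · exact hab h1.symm
  · exact hvb.ne' h1
  · exact hbc h1

end

theorem exists_dominating_of_subharmonic {V : Type*} [Fintype V] {G : SimpleGraph V}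
    [DecidableRel G.Adj] (h : ¬ HasTwoCyclesOfSameLength G) {x : V → ℝ} {ρ : ℝ} {u : V}
    (hx0 : ∀ v, 0 ≤ x v) (hx1 : ∀ v, x v ≤ 1) (hxu : x u = 1) (hρ : 5 ≤ ρ)
    (hρx : ∀ v, ρ * x v ≤ ∑ w, (if G.Adj v w then 1 else 0) * x w)
    (hcard : (Fintype.card V : ℝ) < ρ ^ 2 + 1) :
    (∀ v, v ≠ u → G.Adj u v) ∧ ∃ b c, G.Adj u b ∧ G.Adj u c ∧ G.Adj b c := by
  classical
  set A : V → V → ℝ := fun v w => if G.Adj v w then 1 else 0 with hA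
  set N := univ.filter fun v => G.Adj u v with hN
  set B := univ.filter fun v => (v ≠ u ∧ ¬ G.Adj u v) ∧ ∃ a, G.Adj u a ∧ G.Adj a v with hB
  set F := univ.filter fun v => (v ≠ u ∧ ¬ G.Adj u v) ∧ ¬ ∃ a, G.Adj u a ∧ G.Adj a v with hF
  have hsum (g : V → ℝ) : ∑ v, g v = g u + ∑ v ∈ N, g v + ∑ v ∈ B, g v + ∑ v ∈ F, g v := by
    have hu : g u = ∑ v, if v = u then g v else 0 := by simp
    rw [hu, hN, hB, hF, sum_filter, sum_filter, sum_filter, ← sum_add_distrib, ← sum_add_distrib,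
      ← sum_add_distrib]
    refine sum_congr rfl fun v _ => ?_
    have := G.irrefl (v := u)
    by_cases h1 : v = u
    · subst h1; simp
    · by_cases h2 : G.Adj u v
      · simp [h1, h2]
      · by_cases h3 : ∃ a, G.Adj u a ∧ G.Adj a v <;> simp only [h1, h2, h3] <;> simp [h1]
  have hA0 (v w) : 0 ≤ A v w := by simp only [hA]; split_ifs <;> norm_num
  have hA1 (v w) : A v w ≤ 1 := by simp only [hA]; split_ifs <;> norm_num
  have hc : (Fintype.card V : ℝ) = 1 + #N + #B + #F := by
    simpa using hsum fun _ => 1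
  have hempty : #B + #F = 0 := by
    by_contra hne
    have := sq_le_card_add_of_subharmonic (N := N) (B := B) (F := F) hsum hA0 hA1
      (by simp [hA]) (fun v w => by simp only [hA, G.adj_comm]) hx0 hx1 hxu hρ hρx
      (fun a ha => by simpa [hA, hN] using ha)
      (fun v hv => by
        simp only [hB, mem_filter] at hv
        simp [hA, hv.2.1.2])
      (fun v hv => by
        simp only [hF, mem_filter] at hv
        simp [hA, hv.2.1.2])
      (fun a ha f hf => by
        simp only [hF, hN, mem_filter] at hf ha
        simp only [hA]
        rw [if_neg fun haf => hf.2.2 ⟨a, ha.2, haf⟩])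
      (fun a ha => by
        simp only [hA]
        rw [sum_boole]
        norm_cast
        simp only [hN, mem_filter] at ha
        rw [card_le_one]
        intro b hb c hc
        simp only [hN, mem_filter] at hb hc
        exact eq_of_adj_of_common_neighbor h ha.2 hb.1.2 hc.1.2 hb.2 hc.2)
      (by
        simp only [hA]
        rw [sum_sum_ite_adj]
        norm_cast
        refine card_le_two_of_eq_or_eq_swap fun p hp q hq => ?_
        simp only [hN, mem_filter, mem_product] at hp hq
        exact eq_or_eq_of_adj_of_triangle h hp.1.1.2 hp.1.2.2 hp.2 hq.1.1.2 hq.1.2.2 hq.2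
          hp.1.1.2.ne' hp.1.2.2.ne')
      (fun ⟨v₀, hv₀⟩ => by
        simp only [hA]
        simp_rw [sum_boole]
        norm_cast
        have hle (v) (hv : v ∈ B) : #(N.filter fun a => G.Adj v a) ≤ 2 := by
          by_contra! hlt
          obtain ⟨a, b, c, ha, hb, hc, hab, hac, hbc⟩ := two_lt_card_iff.1 hlt
          simp only [hN, hB, mem_filter] at ha hb hc hv
          exact not_three_common_neighbors h ha.1.2 hb.1.2 hc.1.2 ha.2 hb.2 hc.2 hab hac hbc
            hv.2.1.1
        by_cases hw : ∃ w ∈ B, 1 < #(N.filter fun a => G.Adj w a)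
        · obtain ⟨w, hwB, hw⟩ := hw
          refine ⟨w, hwB, fun v hv hvw => ?_, by exact_mod_cast hle w hwB⟩
          by_contra hlt
          have hlt : 1 < #(N.filter fun a => G.Adj v a) := by
            exact_mod_cast not_le.1 hlt
          obtain ⟨a, b, ha, hb, hab⟩ := one_lt_card_iff.1 hlt
          obtain ⟨a', b', ha', hb', hab'⟩ := one_lt_card_iff.1 hw
          simp only [hN, hB, mem_filter] at ha hb ha' hb' hv hwB
          exact hvw (eq_of_two_common_neighbors h ha.1.2 hb.1.2 ha.2 hb.2 hab ha'.1.2 hb'.1.2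
            ha'.2 hb'.2 hab' hv.2.1 hwB.2.1.1)
        · push Not at hw
          exact ⟨v₀, hv₀, fun v hv _ => by exact_mod_cast hw v hv, by exact_mod_cast hle v₀ hv₀⟩)
      (by
        simp only [hA]
        rw [sum_sum_ite_adj]
        norm_cast
        -- An edge inside `B` whose ends share a neighbour in `N` closes a triangle; any other
        -- closes a pentagon through `u`. Each kind occurs at most once, giving two ordered pairs
        -- each.
        rw [← card_filter_add_card_filter_not fun p => ∃ a, G.Adj u a ∧ G.Adj a p.1 ∧ G.Adj a p.2]
        refine add_le_add (b := 2) (d := 2) (card_le_two_of_eq_or_eq_swap fun p hp q hq => ?_)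
          (card_le_two_of_eq_or_eq_swap fun p hp q hq => ?_)
        · simp only [hB, mem_filter, mem_product] at hp hq
          obtain ⟨a, hua, ha1, ha2⟩ := hp.2
          obtain ⟨b, hub, hb1, hb2⟩ := hq.2
          exact eq_or_eq_of_adj_of_triangle h ha1 ha2 hp.1.2 hb1 hb2 hq.1.2
            (fun e => hp.1.1.1.2.1.2 (e ▸ hub)) (fun e => hp.1.1.2.2.1.2 (e ▸ hub))
        · simp only [hB, mem_filter, mem_product] at hp hq
          obtain ⟨a, hua, ha⟩ := hp.1.1.1.2.2
          obtain ⟨b, hub, hb⟩ := hp.1.1.2.2.2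
          obtain ⟨a', hua', ha'⟩ := hq.1.1.1.2.2
          obtain ⟨b', hub', hb'⟩ := hq.1.1.2.2.2
          exact eq_or_eq_of_adj_of_pentagon h hua hub ha hb hp.1.2 hua' hub' ha' hb' hq.1.2
            (fun e => hp.2 ⟨a, hua, ha, e ▸ hb⟩) (fun e => hq.2 ⟨a', hua', ha', e ▸ hb'⟩)
            hp.1.1.1.2.1 hp.1.1.2.2.1 hq.1.1.1.2.1 hq.1.1.2.2.1)
      (by omega)
    linarith
  have hdom (v) (hv : v ≠ u) : G.Adj u v := by
    by_contra huv
    have hBe := card_eq_zero.1 (Nat.eq_zero_of_add_eq_zero_right hempty)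
    have hFe := card_eq_zero.1 (Nat.eq_zero_of_add_eq_zero_left hempty)
    by_cases h3 : ∃ a, G.Adj u a ∧ G.Adj a v
    · exact notMem_empty v (hBe ▸ by simp [hB, hv, huv, h3])
    · exact notMem_empty v (hFe ▸ by simp only [hF, mem_filter]; exact ⟨mem_univ _, ⟨hv, huv⟩, h3⟩)
  refine ⟨hdom, ?_⟩
  by_contra! hne
  -- Without an edge in `N` the graph is a star, and summing over the leaves gives `ρ² ≤ |N|`.
  have hleaf (a) (ha : a ∈ N) : ρ * x a ≤ 1 := by
    refine (hρx a).trans_eq ?_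
    rw [sum_eq_single u]
    · have : G.Adj a u := by simpa [hN, G.adj_comm] using ha
      simp [this, hxu]
    · intro b _ hb
      rw [if_neg (hne a b (by simpa [hN] using ha) (hdom b hb)), zero_mul]
    · simp
  have hu : ρ * 1 ≤ ∑ a ∈ N, x a := by
    have := hρx u
    rw [hxu] at this
    refine this.trans_eq ?_
    rw [hN, sum_filter]
    exact sum_congr rfl fun v _ => by simp
  have h2 := sum_le_sum hleaf
  rw [← mul_sum, sum_const, nsmul_one] at h2
  have h3 := mul_le_mul_of_nonneg_left hu (by linarith : 0 ≤ ρ)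
  have : (0 : ℝ) ≤ #B + #F := by positivity
  nlinarith

/-! ### Eigenvectors and the spectral radius -/

theorem Matrix.mem_spectrum_iff_exists_mulVec_eq {ι K : Type*} [Fintype ι] [DecidableEq ι]
    [Field K] {M : Matrix ι ι K} {k : K} :
    k ∈ spectrum K M ↔ ∃ y : ι → K, y ≠ 0 ∧ M.mulVec y = k • y := by
  rw [spectrum.mem_iff, Matrix.isUnit_iff_isUnit_det, isUnit_iff_ne_zero, not_not,
    ← Matrix.exists_mulVec_eq_zero_iff]
  simp only [Matrix.sub_mulVec, sub_eq_zero, Algebra.algebraMap_eq_smul_one, Matrix.smul_mulVec,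
    Matrix.one_mulVec, eq_comm (a := k • _)]

theorem exists_adjMatrix_mulVec_of_lt_graphSpectralRadius {V : Type*} [Fintype V]
    {G : SimpleGraph V} [DecidableRel G.Adj] {s : NNReal} (h : (s : ENNReal) < graphSpectralRadius G) :
    ∃ (k : ℝ) (y : V → ℝ), (s : ℝ) < |k| ∧ y ≠ 0 ∧ (G.adjMatrix ℝ).mulVec y = k • y := by
  classical
  rw [graphSpectralRadius, spectralRadius, lt_iSup_iff] at h
  obtain ⟨k, hk⟩ := h
  rw [lt_iSup_iff] at hk
  obtain ⟨hks, hk⟩ := hk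
  obtain ⟨y, hy, hMy⟩ := Matrix.mem_spectrum_iff_exists_mulVec_eq.1 hks
  refine ⟨k, y, ?_, hy, ?_⟩
  · have : s < ‖k‖₊ := by exact_mod_cast hk
    exact_mod_cast this
  · convert hMy

theorem lt_graphSpectralRadius_of_mulVec_eq {V : Type*} [Fintype V]
    {G : SimpleGraph V} [DecidableRel G.Adj] {s : NNReal} {k : ℝ} {y : V → ℝ} (hy : y ≠ 0)
    (hMy : (G.adjMatrix ℝ).mulVec y = k • y) (hs : (s : ℝ) < |k|) :
    (s : ENNReal) < graphSpectralRadius G := by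
  classical
  rw [graphSpectralRadius, spectralRadius]
  refine lt_of_lt_of_le ?_ (le_iSup₂ (f := fun k _ => (‖k‖₊ : ENNReal)) k
    (Matrix.mem_spectrum_iff_exists_mulVec_eq.2 ⟨y, hy, by convert hMy⟩))
  have : s < ‖k‖₊ := by exact_mod_cast hs
  exact_mod_cast this

/-- A maximal-modulus normalisation of an eigenvector gives a subharmonic weight. -/
theorem exists_subharmonic_of_mulVec_eq {V : Type*} [Fintype V] {G : SimpleGraph V}
    [DecidableRel G.Adj] {k : ℝ} {y : V → ℝ} (hy : y ≠ 0)
    (hMy : (G.adjMatrix ℝ).mulVec y = k • y) :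
    ∃ (x : V → ℝ) (u : V), (∀ v, 0 ≤ x v) ∧ (∀ v, x v ≤ 1) ∧ x u = 1 ∧
      ∀ v, |k| * x v ≤ ∑ w, (if G.Adj v w then 1 else 0) * x w := by
  obtain ⟨v₀, hv₀⟩ := Function.ne_iff.1 hy
  obtain ⟨u, -, hu⟩ := exists_max_image univ (fun v => |y v|) ⟨v₀, mem_univ v₀⟩
  have hpos : 0 < |y u| := (abs_pos.2 hv₀).trans_le (hu v₀ (mem_univ _))
  refine ⟨fun v => |y v| / |y u|, u, fun v => by positivity,
    fun v => (div_le_one hpos).2 (hu v (mem_univ v)), div_self hpos.ne', fun v => ?_⟩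
  have h := congrFun hMy v
  simp only [Matrix.mulVec, dotProduct, SimpleGraph.adjMatrix_apply, Pi.smul_apply,
    smul_eq_mul] at h
  simp only [mul_div_assoc']
  rw [← sum_div, ← abs_mul, ← h]
  gcongr
  refine (abs_sum_le_sum_abs _ _).trans (sum_le_sum fun w _ => ?_)
  split_ifs <;> simp

/-! ### The extremal graph: spectral radius, cycles, recognition -/

/-- With `n = m + 3`, an eigenvector equal to `1` at the centre is `1 / (r - 1)` on the triangle
leaves and `1 / r` on the others; the equation at the centre is this cubic. -/
theorem exists_starPlusEdge_root {m : ℝ} (hm : 0 ≤ m) :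
    ∃ r : ℝ, √(m + 2) < r ∧ r ^ 2 * (r - 1) = (m + 2) * (r - 1) + 2 := by
  have hs := Real.sq_sqrt (by linarith : 0 ≤ m + 2)
  have hs0 := Real.sqrt_nonneg (m + 2)
  set s := √(m + 2)
  have hc : ContinuousOn (fun t : ℝ => t ^ 2 * (t - 1) - (m + 2) * (t - 1) - 2)
    (Set.Icc s (s + 2)) := by fun_prop
  -- The left endpoint value is `-2`, which also makes the inequality strict.
  have := intermediate_value_Icc (by linarith) hc
  obtain ⟨r, hr, hr0⟩ := this (show (0 : ℝ) ∈ Set.Icc _ _ by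
    constructor <;> simp only [← hs] <;> nlinarith)
  refine ⟨r, lt_of_le_of_ne hr.1 ?_, by simp only at hr0; linarith⟩
  rintro rfl
  simp only [← hs] at hr0
  linarith

theorem starPlusEdge_adj_iff {n : ℕ} {i j : Fin n} :
    (starPlusEdge n).Adj i j ↔ i ≠ j ∧ ((i.val = 0 ∨ (i.val = 1 ∧ j.val = 2)) ∨
      (j.val = 0 ∨ (j.val = 1 ∧ i.val = 2))) :=
  SimpleGraph.fromRel_adj _ _ _

theorem sqrt_lt_graphSpectralRadius_starPlusEdge {n : ℕ} (hn : 3 ≤ n) :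
    ((NNReal.sqrt (n - 1) : NNReal) : ENNReal) < graphSpectralRadius (starPlusEdge n) := by
  classical
  obtain ⟨m, rfl⟩ := Nat.exists_eq_add_of_le' hn
  obtain ⟨r, hr, hroot⟩ := exists_starPlusEdge_root (m := m) (by positivity)
  have h1r : 1 < r := by
    refine lt_of_le_of_lt ?_ hr
    rw [Real.one_le_sqrt]
    have : (0 : ℝ) ≤ m := by positivity
    linarith
  have hr1 : r - 1 ≠ 0 := by linarith
  have hr0 : r ≠ 0 := by linarith
  let y : Fin (m + 3) → ℝ := fun i => if i.val = 0 then 1 else if i.val ≤ 2 then 1 / (r - 1) else 1 / r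
  refine lt_graphSpectralRadius_of_mulVec_eq (k := r) (y := y) ?_ ?_ ?_
  · exact fun h => one_ne_zero (congrFun h 0)
  · ext i
    rw [Matrix.mulVec, dotProduct]
    simp only [SimpleGraph.adjMatrix_apply, starPlusEdge_adj_iff, ne_eq, Fin.ext_iff,
      Pi.smul_apply, smul_eq_mul, y]
    rw [Fin.sum_univ_succ, Fin.sum_univ_succ, Fin.sum_univ_succ]
    refine Fin.cases ?_ (Fin.cases ?_ (Fin.cases ?_ fun j => ?_)) i <;>
      simp only [Fin.val_zero, Fin.val_succ, Fin.succ_zero_eq_one]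
    · simp
      field_simp
      nlinarith
    · simp
      field_simp
      ring
    · simp
      field_simp
      ring
    · simp
      field_simp
  · rw [abs_of_pos (by linarith)]
    convert hr using 1
    rw [Real.coe_sqrt, NNReal.coe_sub (by norm_cast; omega)]
    push_cast
    ring_nf

/-- Cycle vertices have two neighbours on the cycle, so pendant leaves are excluded; each remaining
vertex must then be joined to both others. -/
theorem toSubgraph_adj_iff_of_isCycle_starPlusEdge {n : ℕ} {u : Fin n}
    {p : (starPlusEdge n).Walk u u} (hp : p.IsCycle) :
    (∀ i, i ∈ p.toSubgraph.verts ↔ i.val ≤ 2) ∧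
      ∀ i j, p.toSubgraph.Adj i j ↔ i ≠ j ∧ i.val ≤ 2 ∧ j.val ≤ 2 := by
  have hdeg {i} (hi : i ∈ p.toSubgraph.verts) : ∃ j k, j ≠ k ∧ p.toSubgraph.neighborSet i = {j, k} :=
    Set.ncard_eq_two.1 (hp.ncard_neighborSet_toSubgraph_eq_two (by simpa using hi))
  have hsub {i j} (h : p.toSubgraph.Adj i j) := starPlusEdge_adj_iff.1 h.adj_sub
  have hle {i} (hi : i ∈ p.toSubgraph.verts) : i.val ≤ 2 := by
    obtain ⟨j, k, hjk, hN⟩ := hdeg hi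
    have hj := hsub (show j ∈ p.toSubgraph.neighborSet i by simp [hN])
    have hk := hsub (show k ∈ p.toSubgraph.neighborSet i by simp [hN])
    have := Fin.val_ne_of_ne hjk
    omega
  have hadj {i j} (hi : i ∈ p.toSubgraph.verts) (hij : i ≠ j) (hj : j.val ≤ 2) :
      p.toSubgraph.Adj i j := by
    obtain ⟨k, l, hkl, hN⟩ := hdeg hi
    have hk : p.toSubgraph.Adj i k := show k ∈ p.toSubgraph.neighborSet i by simp [hN]
    have hl : p.toSubgraph.Adj i l := show l ∈ p.toSubgraph.neighborSet i by simp [hN]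
    have h1 := hle hi
    have h2 := hle hk.snd_mem
    have h3 := hle hl.snd_mem
    have h4 := Fin.val_ne_of_ne hkl
    have h5 := Fin.val_ne_of_ne hk.ne
    have h6 := Fin.val_ne_of_ne hl.ne
    have h7 := Fin.val_ne_of_ne hij
    rcases (by omega : j.val = k.val ∨ j.val = l.val) with h | h
    · rwa [Fin.ext h]
    · rwa [Fin.ext h]
  have hmem (i) (hi : i.val ≤ 2) : i ∈ p.toSubgraph.verts := by
    have hu : u ∈ p.toSubgraph.verts := by simp
    by_cases hiu : u = i
    · exact hiu ▸ hu
    · exact (hadj hu hiu hi).snd_mem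
  exact ⟨fun i => ⟨hle, hmem i⟩, fun i j => ⟨fun h => ⟨h.ne, hle h.fst_mem, hle h.snd_mem⟩,
    fun h => hadj (hmem i h.2.1) h.1 h.2.2⟩⟩

theorem not_hasTwoCyclesOfSameLength_starPlusEdge (n : ℕ) :
    ¬ HasTwoCyclesOfSameLength (starPlusEdge n) := by
  rintro ⟨u, v, p, q, hp, hq, -, hne⟩
  have h1 := toSubgraph_adj_iff_of_isCycle_starPlusEdge hp
  have h2 := toSubgraph_adj_iff_of_isCycle_starPlusEdge hq
  refine hne (SimpleGraph.Subgraph.ext ?_ ?_)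
  · ext i
    rw [h1.1, h2.1]
  · ext i j
    rw [h1.2, h2.2]

theorem HasTwoCyclesOfSameLength.map {V W : Type*} {G : SimpleGraph V} {H : SimpleGraph W}
    (h : HasTwoCyclesOfSameLength G) (e : G ≃g H) : HasTwoCyclesOfSameLength H := by
  obtain ⟨u, v, p, q, hp, hq, hl, hne⟩ := h
  refine ⟨_, _, p.map e.toHom, q.map e.toHom, hp.map e.injective, hq.map e.injective,
    by simpa using hl, fun heq => hne ?_⟩
  rw [SimpleGraph.Walk.toSubgraph_map, SimpleGraph.Walk.toSubgraph_map] at heq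
  refine SimpleGraph.Subgraph.ext (Set.image_injective.2 e.injective
    (congrArg SimpleGraph.Subgraph.verts heq)) ?_
  ext v w
  have h := congrFun (congrFun (congrArg SimpleGraph.Subgraph.Adj heq) (e v)) (e w)
  simpa [Relation.Map] using h

theorem nonempty_iso_starPlusEdge {V : Type*} [Fintype V] {G : SimpleGraph V} {n : ℕ}
    (hcard : Fintype.card V = n) {u b c : V} (hdom : ∀ v, v ≠ u → G.Adj u v)
    (hb : G.Adj u b) (hc : G.Adj u c) (hbc : G.Adj b c)
    (huniq : ∀ b' c', G.Adj u b' → G.Adj u c' → G.Adj b' c' → (b' = b ∧ c' = c) ∨ (b' = c ∧ c' = b)) :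
    Nonempty (G ≃g starPlusEdge n) := by
  classical
  have hcard3 : #({u, b, c} : Finset V) = 3 := by
    simp [hb.ne, hc.ne, hbc.ne]
  have hn : 3 ≤ n := by
    rw [← hcard, ← hcard3]
    exact card_le_univ _
  let e₀ : V ≃ Fin n := Fintype.equivFinOfCardEq hcard
  -- Three transpositions send `u`, `b`, `c` to `0`, `1`, `2`; each fixes the positions already set.
  let e₁ := e₀.trans (Equiv.swap (e₀ u) ⟨0, by omega⟩)
  let e₂ := e₁.trans (Equiv.swap (e₁ b) ⟨1, by omega⟩)
  let e := e₂.trans (Equiv.swap (e₂ c) ⟨2, by omega⟩)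
  have h1u : e₁ u = ⟨0, by omega⟩ := by simp [e₁]
  have h2b : e₂ b = ⟨1, by omega⟩ := by simp [e₂]
  have hec : e c = ⟨2, by omega⟩ := by simp [e]
  have h2u : e₂ u = ⟨0, by omega⟩ := by
    rw [← h1u]
    refine Equiv.swap_apply_of_ne_of_ne (e₁.injective.ne hb.ne) ?_
    rw [h1u]; simp
  have heu : e u = ⟨0, by omega⟩ := by
    rw [← h2u]
    refine Equiv.swap_apply_of_ne_of_ne (e₂.injective.ne hc.ne) ?_
    rw [h2u]; simp
  have heb : e b = ⟨1, by omega⟩ := by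
    rw [← h2b]
    refine Equiv.swap_apply_of_ne_of_ne (e₂.injective.ne hbc.ne) ?_
    rw [h2b]; simp
  have hu0 (v) : (e v).val = 0 ↔ v = u := by
    rw [← e.injective.eq_iff, heu, Fin.ext_iff]
  have hb1 (v) : (e v).val = 1 ↔ v = b := by
    rw [← e.injective.eq_iff, heb, Fin.ext_iff]
  have hc2 (v) : (e v).val = 2 ↔ v = c := by
    rw [← e.injective.eq_iff, hec, Fin.ext_iff]
  refine ⟨⟨e, fun {v w} => ?_⟩⟩
  rw [starPlusEdge_adj_iff, hu0, hu0, hb1, hb1, hc2, hc2, e.injective.ne_iff]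
  constructor
  · rintro ⟨hne, (rfl | ⟨rfl, rfl⟩) | (rfl | ⟨rfl, rfl⟩)⟩
    · exact hdom w hne.symm
    · exact hbc
    · exact (hdom v hne).symm
    · exact hbc.symm
  · intro h
    refine ⟨h.ne, ?_⟩
    by_cases hv : v = u
    · exact Or.inl (Or.inl hv)
    by_cases hw : w = u
    · exact Or.inr (Or.inl hw)
    have := huniq v w (hdom v hv) (hdom w hw) h
    tauto

theorem theorem1p2 {V : Type*} [Fintype V] (G : SimpleGraph V) (n : ℕ)
    (hcard : Fintype.card V = n) (hn : 26 ≤ n)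
    (hρ : graphSpectralRadius (starPlusEdge n) ≤ graphSpectralRadius G) :
    HasTwoCyclesOfSameLength G ↔ ¬ Nonempty (G ≃g starPlusEdge n) := by
  classical
  refine ⟨fun h ⟨e⟩ => not_hasTwoCyclesOfSameLength_starPlusEdge n (h.map e), ?_⟩
  contrapose!
  intro h
  obtain ⟨k, y, hk, hy, hMy⟩ := exists_adjMatrix_mulVec_of_lt_graphSpectralRadius
    ((sqrt_lt_graphSpectralRadius_starPlusEdge (by omega)).trans_le hρ)
  obtain ⟨x, u, hx0, hx1, hxu, hx⟩ := exists_subharmonic_of_mulVec_eq hy hMy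
  have hn' : (26 : ℝ) ≤ n := by exact_mod_cast hn
  rw [Real.coe_sqrt, NNReal.coe_sub (by norm_cast; omega), NNReal.coe_natCast, NNReal.coe_one] at hk
  -- The bound `n ≥ 26` enters here, as `n - 1 ≥ 5²`.
  have h5 : 5 ≤ √((n : ℝ) - 1) := Real.le_sqrt_of_sq_le (by linarith)
  have hk2 : (n : ℝ) - 1 < |k| ^ 2 := (Real.sqrt_lt' (by linarith)).1 hk
  obtain ⟨hdom, b, c, hb, hc, hbc⟩ := exists_dominating_of_subharmonic h hx0 hx1 hxu
    (h5.trans hk.le) hx (by rw [hcard]; linarith)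
  refine nonempty_iso_starPlusEdge hcard hdom hb hc hbc fun b' c' hb' hc' hbc' => ?_
  simpa using eq_or_eq_of_adj_of_triangle h hb' hc' hbc' hb hc hbc hb'.ne' hc'.ne'
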